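/- Let $\mathcal{A}$ be a (possibly infinite) set of action names with $|\mathcal{A}|\ge 2$, let $\overline{\mathcal{A}}=\{\overline a\mid a\in\mathcal{A}\}$ be a disjoint set of co-names (with $\overline{\overline a}=a$), and let $\mathcal{A}_\tau=\mathcal{A}\cup\overline{\mathcal{A}}\cup\{\tau\}$. CCS terms are given by $t::=\mathbf 0\mid x\mid \mu.t\mid t+t\mid t\parallel t$, where $\mu\in\mathcal{A}_\tau$ and $x$ ranges over a countably infinite set of variables; terms are considered modulo associativity and commutativity of $+$. Processes are the closed terms. Their transitions are those derivable from the rules: $\mu.p\xrightarrow{\mu}p$; if $p\xrightarrow{\mu}p'$ then $p+q\xrightarrow{\mu}p'$, $q+p\xrightarrow{\mu}p'$, $p\parallel q\xrightarrow{\mu}p'\parallel q$ and $q\parallel p\xrightarrow{\mu}q\parallel p'$; if $p\xrightarrow{\alpha}p'$ and $q\xrightarrow{\overline\alpha}q'$ with $\alpha\in\mathcal{A}\cup\overline{\mathcal{A}}$, then $p\parallel q\xrightarrow{\tau}p'\parallel q'$. For $\varphi\in\mathcal{A}_\tau^*$ write $p\xrightarrow{\varphi}p'$ for a sequence of transitions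 labelled by $\varphi$, and call $\varphi$ a trace of $p$ if $p\xrightarrow{\varphi}p'$ for some $p'$. Behavioural equivalences on processes: - *$n$-nested trace equivalence* $\sim^{T}_n$: $\sim^T_0$ is the universal relation, and $p\sim^T_{n+1}q$ iff for every $\varphi$, each $p\xrightarrow{\varphi}p'$ is matched by some $q\xrightarrow{\varphi}q'$ with $p'\sim^T_n q'$, and vice versa. - *$n$-nested simulation equivalence*: a simulation is a relation $R$ such that $p\,R\,q$ and $p\xrightarrow{\mu}p'$ imply $q\xrightarrow{\mu}q'$ with $p'\,R\,q'$ for some $q'$. Let $\sqsubseteq_0$ be the universal relation, and let $p\sqsubseteq_{n+1}q$ iff $p\,R\,q$ for some simulation $R$ with $R^{-1}\subseteq{\sqsubseteq_n}$. Then $p,q$ are $n$-nested simulation equivalent iff $p\sqsubseteq_n q$ and $q\sqsubseteq_n p$. - *Possible futures equivalence* $\sim_{PF}$: $p\sim_{PF}q$ iff the sets $\{(\varphi,X)\mid p\xrightarrow{\varphi}p'\text{ for some }p'\text{ whose set of traces is }X\}$ for $p$ and for $q$ coincide. - *Bisimilarity*: the largest symmetric simulation. An equation $t\approx u$ is sound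 modulo $\sim$ if $\sigma(t)\sim\sigma(u)$ for all closed substitutions $\sigma$; a set $\mathcal{E}$ of equations is sound if all its members are. $\mathcal{E}\vdash t\approx u$ means that $t\approx u$ is inferred from $\mathcal{E}$ by reflexivity, symmetry, transitivity, substitution and closure under the CCS operators. $\mathcal{E}$ is ground-complete modulo $\sim$ if $\mathcal{E}\vdash p\approx q$ for all processes $p\sim q$. **Theorem.** 1. For every $n\ge 2$, there is no finite set of equations over CCS that is sound and ground-complete modulo $n$-nested trace equivalence, and there is none that is sound and ground-complete modulo $n$-nested simulation equivalence. 2. Let $a,b\in\mathcal{A}$ with $a\ne b$ and, for $N\ge 1$, let $p_N=\sum_{i=1}^N b^i a$ and let $e_N$ be the equation $$a\parallel p_N\;\approx\; a\,p_N+\sum_{i=1}^N b\,(a\parallel b^{i-1}a)$$ (trailing $\mathbf 0$'s omitted). Then every $e_N$ is sound modulo bisimilarity; and for every finite set $\mathcal{E}$ of equations over CCS that is sound modulo $\sim_{PF}$, there is an $N_0$ such that $\mathcal{E}\nvdash e_N$ for all $N\ge N_0$. -/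

import Mathlib

namespace CCS

/-! ### Labelled transition systems and behavioural equivalences -/

section LTS

universe u v

variable {S : Type u} {L : Type v}

/-- `Steps step p φ q`: there is a sequence of transitions from `p` to `q` labelled by `φ`. -/
inductive Steps (step : S → L → S → Prop) : S → List L → S → Prop
  | refl (p : S) : Steps step p [] p
  | cons {p p' q : S} {μ : L} {φ : List L} :
      step p μ p' → Steps step p' φ q → Steps step p (μ :: φ) q

/-- The set of traces of a state. -/
def traces (step : S → L → S → Prop) (p : S) : Set (List L) :=
  {φ | ∃ q, Steps step p φ q}

/-- The possible futures of `p`: the pairs `(φ, X)` such that `p` can perform `φ` and reach a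
state whose set of traces is `X`. -/
def possibleFutures (step : S → L → S → Prop) (p : S) : Set (List L × Set (List L)) :=
  {x | ∃ q, Steps step p x.1 q ∧ x.2 = traces step q}

/-- Possible futures equivalence. -/
def PFEquiv (step : S → L → S → Prop) (p q : S) : Prop :=
  possibleFutures step p = possibleFutures step q

/-- `n`-nested trace equivalence: `0`-nested trace equivalence is the universal relation, and
`p`, `q` are `(n+1)`-nested trace equivalent if every sequence of transitions of one of them can
be matched by the other, with the same labels, leading to `n`-nested trace equivalent states. -/
def NestedTraceEquiv (step : S → L → S → Prop) : ℕ → S → S → Prop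
  | 0 => fun _ _ => True
  | n + 1 => fun p q => ∀ φ : List L,
      (∀ p', Steps step p φ p' → ∃ q', Steps step q φ q' ∧ NestedTraceEquiv step n p' q') ∧
      (∀ q', Steps step q φ q' → ∃ p', Steps step p φ p' ∧ NestedTraceEquiv step n p' q')

/-- `R` is a simulation. -/
def IsSimulation (step : S → L → S → Prop) (R : S → S → Prop) : Prop :=
  ∀ p q, R p q → ∀ μ p', step p μ p' → ∃ q', step q μ q' ∧ R p' q'

/-- The `n`-nested simulation preorder: the `0`-nested one is the universal relation, and
`p` is below `q` in the `(n+1)`-nested one if `R p q` for some simulation `R` whose converse is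
contained in the `n`-nested simulation preorder. -/
def NestedSimLE (step : S → L → S → Prop) : ℕ → S → S → Prop
  | 0 => fun _ _ => True
  | n + 1 => fun p q => ∃ R : S → S → Prop,
      IsSimulation step R ∧ (∀ x y, R x y → NestedSimLE step n y x) ∧ R p q

/-- `n`-nested simulation equivalence. -/
def NestedSimEquiv (step : S → L → S → Prop) (n : ℕ) (p q : S) : Prop :=
  NestedSimLE step n p q ∧ NestedSimLE step n q p

/-- Bisimilarity: the largest symmetric simulation. -/
def Bisimilar (step : S → L → S → Prop) (p q : S) : Prop :=
  ∃ R : S → S → Prop, (∀ x y, R x y → R y x) ∧ IsSimulation step R ∧ R p q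

end LTS

/-! ### The language CCS -/

universe u v w

/-- The visible actions: the names in `A` and their co-names. -/
inductive Label (A : Type u) : Type u
  | name (a : A) : Label A
  | coname (a : A) : Label A

/-- Complementation of visible actions. -/
def Label.compl {A : Type u} : Label A → Label A
  | .name a => .coname a
  | .coname a => .name a

/-- All actions: visible actions and the action `τ`. -/
inductive Act (A : Type u) : Type u
  | vis (α : Label A) : Act A
  | tau : Act A

/-- Terms of the recursion, restriction and relabelling free fragment of CCS over the set of
names `A`, with variables in `V`. -/
inductive Term (A : Type u) (V : Type v) : Type (max u v)
  | nil : Term A V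
  | var (x : V) : Term A V
  | pre (μ : Act A) (t : Term A V) : Term A V
  | plus (t u : Term A V) : Term A V
  | par (t u : Term A V) : Term A V

/-- Processes, i.e. closed terms: terms without variables. -/
abbrev Proc (A : Type u) : Type u := Term A Empty

/-- Application of a substitution to a term. -/
def Term.subst {A : Type u} {V : Type v} {W : Type w} (σ : V → Term A W) : Term A V → Term A W
  | .nil => .nil
  | .var x => σ x
  | .pre μ t => .pre μ (t.subst σ)
  | .plus t u => .plus (t.subst σ) (u.subst σ)
  | .par t u => .par (t.subst σ) (u.subst σ)

/-- A process, seen as a term over an arbitrary set of variables. -/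
def Proc.toTerm {A : Type u} {V : Type v} (p : Proc A) : Term A V :=
  Term.subst (fun x : Empty => x.elim) p

/-- The operational semantics: the least transition relation satisfying the SOS rules. -/
inductive Step {A : Type u} : Proc A → Act A → Proc A → Prop
  | pre (μ : Act A) (p : Proc A) : Step (.pre μ p) μ p
  | plusLeft {p q p' : Proc A} {μ : Act A} : Step p μ p' → Step (.plus p q) μ p'
  | plusRight {p q q' : Proc A} {μ : Act A} : Step q μ q' → Step (.plus p q) μ q'
  | parLeft {p q p' : Proc A} {μ : Act A} : Step p μ p' → Step (.par p q) μ (.par p' q)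
  | parRight {p q q' : Proc A} {μ : Act A} : Step q μ q' → Step (.par p q) μ (.par p q')
  | comm {p q p' q' : Proc A} {α : Label A} :
      Step p (.vis α) p' → Step q (.vis α.compl) q' → Step (.par p q) .tau (.par p' q')

/-! ### Equational logic -/

/-- An equation `t ≈ u` between CCS terms over the countably infinite set `ℕ` of variables. -/
abbrev Equation (A : Type u) : Type u := Term A ℕ × Term A ℕ

/-- `Derivable E t u`: the equation `t ≈ u` can be inferred from the axioms in `E` by the rules of
equational logic. Terms are considered modulo associativity and commutativity of `+`; this
identification is rendered by the constructors `plusComm` and `plusAssoc`. -/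
inductive Derivable {A : Type u} (E : Set (Equation A)) : Term A ℕ → Term A ℕ → Prop
  | ax {t u : Term A ℕ} : (t, u) ∈ E → Derivable E t u
  | refl (t : Term A ℕ) : Derivable E t t
  | symm {t u : Term A ℕ} : Derivable E t u → Derivable E u t
  | trans {t u v : Term A ℕ} : Derivable E t u → Derivable E u v → Derivable E t v
  | subst (σ : ℕ → Term A ℕ) {t u : Term A ℕ} :
      Derivable E t u → Derivable E (t.subst σ) (u.subst σ)
  | pre (μ : Act A) {t u : Term A ℕ} : Derivable E t u → Derivable E (.pre μ t) (.pre μ u)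
  | plus {t u t' u' : Term A ℕ} :
      Derivable E t u → Derivable E t' u' → Derivable E (.plus t t') (.plus u u')
  | par {t u t' u' : Term A ℕ} :
      Derivable E t u → Derivable E t' u' → Derivable E (.par t t') (.par u u')
  | plusComm (t u : Term A ℕ) : Derivable E (.plus t u) (.plus u t)
  | plusAssoc (t u v : Term A ℕ) :
      Derivable E (.plus (.plus t u) v) (.plus t (.plus u v))

/-- An equation is sound modulo a relation on processes if all its closed instances are in the
relation. -/
def SoundEq {A : Type u} (rel : Proc A → Proc A → Prop) (e : Equation A) : Prop :=
  ∀ σ : ℕ → Proc A, rel (e.1.subst σ) (e.2.subst σ)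

/-- An axiom system is sound if all its equations are. -/
def Sound {A : Type u} (rel : Proc A → Proc A → Prop) (E : Set (Equation A)) : Prop :=
  ∀ e ∈ E, SoundEq rel e

/-- An axiom system is ground-complete if it proves all valid equations between closed terms. -/
def GroundComplete {A : Type u} (rel : Proc A → Proc A → Prop)
    (E : Set (Equation A)) : Prop :=
  ∀ p q : Proc A, rel p q → Derivable E p.toTerm q.toTerm

/-- There is a finite axiom system that is sound and ground-complete modulo `rel`. -/
def HasFiniteGroundCompleteAxiomatisation {A : Type u}
    (rel : Proc A → Proc A → Prop) : Prop :=
  ∃ E : Set (Equation A), E.Finite ∧ Sound rel E ∧ GroundComplete rel E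

/-! ### The family of equations `e_N` -/

/-- The summation `t₁ + ⋯ + tₖ`; the empty sum is `0`. -/
def summation {A : Type u} : List (Proc A) → Proc A
  | [] => .nil
  | [t] => t
  | t :: u :: l => .plus t (summation (u :: l))

/-- The action of a name. -/
def act {A : Type u} (a : A) : Act A := .vis (.name a)

/-- The process `a`, i.e. `a.0`. -/
def single {A : Type u} (a : A) : Proc A := .pre (act a) .nil

/-- The process `b^i a`. -/
def powThen {A : Type u} (a b : A) (i : ℕ) : Proc A := (Term.pre (act b))^[i] (single a)

/-- `p_N = ∑_{i=1}^N b^i a`. -/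
def pSum {A : Type u} (a b : A) (N : ℕ) : Proc A :=
  summation ((List.range N).map fun j => powThen a b (j + 1))

/-- The left-hand side `a ‖ p_N` of `e_N`. -/
def eLHS {A : Type u} (a b : A) (N : ℕ) : Proc A := .par (single a) (pSum a b N)

/-- The right-hand side `a p_N + ∑_{i=1}^N b (a ‖ b^{i-1} a)` of `e_N`. -/
def eRHS {A : Type u} (a b : A) (N : ℕ) : Proc A :=
  .plus (.pre (act a) (pSum a b N))
    (summation ((List.range N).map fun j => .pre (act b) (.par (single a) (powThen a b j))))

/-- The (closed) equation `e_N`. -/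
def eEq {A : Type u} (a b : A) (N : ℕ) : Equation A :=
  ((eLHS a b N).toTerm, (eRHS a b N).toTerm)

end CCS

namespace CCS

/-! ### Comparison of the equivalences, and futures after one transition. -/

section LTS

variable {S L : Type*} {step : S → L → S → Prop}

/-! All equivalences in question contain bisimilarity and are contained in possible futures
equivalence, so everything reduces to the underivability of `e_N`. Of possible futures only a
weakening is used: `FutEquiv`, which compares the trace sets of the derivatives after one step. It
is a congruence.

The invariant is `HasParSummand`: up to inert components, some summand is a parallel composition of
a component with the traces of `a` and one with the traces of `p_N`. The left side of `e_N` has this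
property and the right side, a sum of prefixes, does not. The property is preserved by derivations,
among processes whose futures lie below those of `a ‖ p_N`, as long as every axiom has fewer than
`N` prefix bodies on each side (`Derivable.futEquiv_and_hasParSummand_iff`).

The crux is a closed instance of an axiom `t ≈ u` in which `t` has the summand. Either a variable
supplies the whole summand, or the component tracing like `p_N` must obtain one of its `N`
distinguishable `b`-derivatives from a variable `x`, by pigeonhole
(`exists_step_addTau_of_traces_eq_pSum`). Adding a summand `τ` to `σ x` gives `t` a `τ`-step that
discards the contribution of `x`, leaving an inert process or one with the traces of `a`. Soundness
makes `u` match this step, and since `u` had no `τ` before, the step reveals where `x` stands in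
`u`. This reconstructs the summand (`hasParSummand_of_step_addTau_inert`,
`hasParSummand_of_step_addTau`). -/

theorem nil_mem_traces (p : S) : [] ∈ traces step p := ⟨p, .refl p⟩

theorem cons_mem_traces {p : S} {μ : L} {φ : List L} :
    μ :: φ ∈ traces step p ↔ ∃ p', step p μ p' ∧ φ ∈ traces step p' := by
  constructor
  · rintro ⟨q, h⟩
    cases h with
    | cons h₁ h₂ => exact ⟨_, h₁, _, h₂⟩
  · rintro ⟨p', h₁, q, h₂⟩
    exact ⟨q, .cons h₁ h₂⟩

theorem singleton_mem_traces {p p' : S} {μ : L} (h : step p μ p') : [μ] ∈ traces step p :=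
  cons_mem_traces.2 ⟨p', h, nil_mem_traces p'⟩

theorem steps_singleton {p q : S} {μ : L} : Steps step p [μ] q ↔ step p μ q := by
  constructor
  · intro h
    cases h with
    | cons h₁ h₂ => cases h₂; exact h₁
  · exact fun h => .cons h (.refl q)

theorem IsSimulation.steps {R : S → S → Prop} (hR : IsSimulation step R) {p p' : S} {φ : List L}
    (h : Steps step p φ p') : ∀ q, R p q → ∃ q', Steps step q φ q' ∧ R p' q' := by
  induction h with
  | refl p => exact fun q hq => ⟨q, .refl q, hq⟩
  | cons h₁ _ ih =>
    intro q hq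
    obtain ⟨q₁, hs, hr⟩ := hR _ _ hq _ _ h₁
    obtain ⟨q', hs', hr'⟩ := ih q₁ hr
    exact ⟨q', .cons hs hs', hr'⟩

theorem Bisimilar.nestedTraceEquiv {p q : S} (h : Bisimilar step p q) (n : ℕ) :
    NestedTraceEquiv step n p q := by
  obtain ⟨R, hsymm, hR, hpq⟩ := h
  induction n generalizing p q with
  | zero => trivial
  | succ n ih =>
    refine fun φ => ⟨fun p' hp => ?_, fun q' hq => ?_⟩
    · obtain ⟨q', hs, hr⟩ := hR.steps hp q hpq
      exact ⟨q', hs, ih hr⟩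
    · obtain ⟨p', hs, hr⟩ := hR.steps hq p (hsymm _ _ hpq)
      exact ⟨p', hs, ih (hsymm _ _ hr)⟩

theorem Bisimilar.nestedSimEquiv {p q : S} (h : Bisimilar step p q) (n : ℕ) :
    NestedSimEquiv step n p q := by
  obtain ⟨R, hsymm, hR, hpq⟩ := h
  have key : ∀ n x y, R x y → NestedSimLE step n x y := by
    intro n
    induction n with
    | zero => exact fun _ _ _ => trivial
    | succ n ih => exact fun x y hxy => ⟨R, hR, fun x y h => ih y x (hsymm _ _ h), hxy⟩
  exact ⟨key n p q hpq, key n q p (hsymm _ _ hpq)⟩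

theorem NestedTraceEquiv.traces_eq {n : ℕ} {p q : S} (h : NestedTraceEquiv step (n + 1) p q) :
    traces step p = traces step q := by
  ext φ
  constructor
  · rintro ⟨p', hp⟩
    obtain ⟨q', hq, -⟩ := (h φ).1 p' hp
    exact ⟨q', hq⟩
  · rintro ⟨q', hq⟩
    obtain ⟨p', hp, -⟩ := (h φ).2 q' hq
    exact ⟨p', hp⟩

/-- Level `n + 2` matches derivatives up to level `n + 1`, which already determines their traces. -/
theorem NestedTraceEquiv.pfEquiv {n : ℕ} {p q : S} (h : NestedTraceEquiv step (n + 2) p q) :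
    PFEquiv step p q := by
  ext ⟨φ, X⟩
  constructor
  · rintro ⟨p', hp, hX⟩
    obtain ⟨q', hq, he⟩ := (h φ).1 p' hp
    exact ⟨q', hq, hX.trans (traces_eq he)⟩
  · rintro ⟨q', hq, hX⟩
    obtain ⟨p', hp, he⟩ := (h φ).2 q' hq
    exact ⟨p', hp, hX.trans (traces_eq he).symm⟩

theorem IsSimulation.traces_subset {R : S → S → Prop} (hR : IsSimulation step R) {p q : S}
    (h : R p q) : traces step p ⊆ traces step q := by
  rintro φ ⟨p', hp⟩
  obtain ⟨q', hq, -⟩ := hR.steps hp q h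
  exact ⟨q', hq⟩

theorem NestedSimLE.traces_subset {n : ℕ} {p q : S} (h : NestedSimLE step (n + 1) p q) :
    traces step p ⊆ traces step q := by
  obtain ⟨R, hR, -, hpq⟩ := h
  exact hR.traces_subset hpq

/-- Matched derivatives stay in the simulation, giving one trace inclusion; its converse lies in the
preorder of level `n + 1`, giving the other. -/
theorem NestedSimLE.possibleFutures_subset {n : ℕ} {p q : S} (h : NestedSimLE step (n + 2) p q) :
    possibleFutures step p ⊆ possibleFutures step q := by
  obtain ⟨R, hR, hinv, hpq⟩ := h
  rintro ⟨φ, X⟩ ⟨p', hp, hX⟩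
  obtain ⟨q', hq, hr⟩ := hR.steps hp q hpq
  exact ⟨q', hq, hX.trans ((hR.traces_subset hr).antisymm (traces_subset (hinv _ _ hr)))⟩

theorem NestedSimEquiv.pfEquiv {n : ℕ} {p q : S} (h : NestedSimEquiv step (n + 2) p q) :
    PFEquiv step p q :=
  h.1.possibleFutures_subset.antisymm h.2.possibleFutures_subset

/-- Every transition of `p` is matched by a transition of `q` to a trace equivalent state. -/
def FutLE (step : S → L → S → Prop) (p q : S) : Prop :=
  ∀ μ p', step p μ p' → ∃ q', step q μ q' ∧ traces step p' = traces step q'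

theorem FutLE.refl (p : S) : FutLE step p p := fun _ p' h => ⟨p', h, rfl⟩

theorem FutLE.trans {p q r : S} (h : FutLE step p q) (h' : FutLE step q r) : FutLE step p r := by
  intro μ p' hp
  obtain ⟨q', hq, e⟩ := h μ p' hp
  obtain ⟨r', hr, e'⟩ := h' μ q' hq
  exact ⟨r', hr, e.trans e'⟩

theorem FutLE.traces_subset {p q : S} (h : FutLE step p q) : traces step p ⊆ traces step q := by
  intro φ hφ
  cases φ with
  | nil => exact nil_mem_traces q
  | cons μ φ =>
    obtain ⟨p', hp, hφ⟩ := cons_mem_traces.1 hφ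
    obtain ⟨q', hq, e⟩ := h μ p' hp
    exact cons_mem_traces.2 ⟨q', hq, e ▸ hφ⟩

/-- `p` and `q` have the same futures after one transition, up to trace equivalence. -/
def FutEquiv (step : S → L → S → Prop) (p q : S) : Prop :=
  FutLE step p q ∧ FutLE step q p

theorem FutEquiv.symm {p q : S} (h : FutEquiv step p q) : FutEquiv step q p := ⟨h.2, h.1⟩

theorem FutEquiv.traces_eq {p q : S} (h : FutEquiv step p q) : traces step p = traces step q :=
  h.1.traces_subset.antisymm h.2.traces_subset

theorem FutLE.of_possibleFutures_subset {p q : S}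
    (h : possibleFutures step p ⊆ possibleFutures step q) : FutLE step p q := by
  intro μ p' hp
  obtain ⟨q', hq, e⟩ := h (show ([μ], traces step p') ∈ possibleFutures step p from
    ⟨p', steps_singleton.2 hp, rfl⟩)
  exact ⟨q', steps_singleton.1 hq, e⟩

theorem PFEquiv.futEquiv {p q : S} (h : PFEquiv step p q) : FutEquiv step p q :=
  ⟨.of_possibleFutures_subset h.subset, .of_possibleFutures_subset h.superset⟩

/-- `p` has no transitions. -/
def Inert (step : S → L → S → Prop) (p : S) : Prop := ∀ μ p', ¬ step p μ p'

theorem Inert.of_traces_subset {p q : S} (hq : Inert step q)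
    (h : traces step p ⊆ traces step q) : Inert step p := by
  intro μ p' hp
  obtain ⟨q', hs, -⟩ := cons_mem_traces.1 (h (singleton_mem_traces hp))
  exact hq μ q' hs

theorem inert_congr {p q : S} (h : traces step p = traces step q) :
    Inert step p ↔ Inert step q :=
  ⟨fun hp => hp.of_traces_subset h.superset, fun hq => hq.of_traces_subset h.subset⟩

theorem exists_step_of_not_inert {p : S} (h : ¬ Inert step p) : ∃ μ p', step p μ p' := by
  simpa [Inert] using h

end LTS

/-! ### Traces of sums and of parallel compositions -/

section Traces

variable {A : Type*} {p q r p' q' : Proc A} {μ : Act A}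

theorem step_pre_iff {ν : Act A} : Step (.pre μ p) ν q ↔ ν = μ ∧ q = p := by
  constructor
  · intro h
    cases h
    exact ⟨rfl, rfl⟩
  · rintro ⟨rfl, rfl⟩
    exact .pre _ _

theorem step_plus_iff : Step (.plus p q) μ r ↔ Step p μ r ∨ Step q μ r := by
  constructor
  · intro h
    cases h with
    | plusLeft h => exact .inl h
    | plusRight h => exact .inr h
  · rintro (h | h)
    · exact .plusLeft h
    · exact .plusRight h

theorem not_step_nil : ¬ Step (.nil : Proc A) μ p := nofun

theorem inert_nil : Inert Step (.nil : Proc A) := fun _ _ => not_step_nil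

/-- `Interleave φ ψ χ`: the trace `χ` results from interleaving `φ` and `ψ`, with possible
synchronisations of complementary actions. -/
inductive Interleave {A : Type*} : List (Act A) → List (Act A) → List (Act A) → Prop
  | nil : Interleave [] [] []
  | left {φ ψ χ : List (Act A)} (μ : Act A) : Interleave φ ψ χ → Interleave (μ :: φ) ψ (μ :: χ)
  | right {φ ψ χ : List (Act A)} (μ : Act A) : Interleave φ ψ χ → Interleave φ (μ :: ψ) (μ :: χ)
  | comm {φ ψ χ : List (Act A)} (α : Label A) : Interleave φ ψ χ →
      Interleave (.vis α :: φ) (.vis α.compl :: ψ) (.tau :: χ)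

/-- The traces of a composition depend only on those of its components, so trace equivalence is a
congruence for `‖`. -/
theorem mem_traces_par {χ : List (Act A)} : χ ∈ traces Step (.par p q) ↔
    ∃ φ ∈ traces Step p, ∃ ψ ∈ traces Step q, Interleave φ ψ χ := by
  constructor
  · intro h
    induction χ generalizing p q with
    | nil => exact ⟨[], nil_mem_traces p, [], nil_mem_traces q, .nil⟩
    | cons μ χ ih =>
      obtain ⟨r, hs, hr⟩ := cons_mem_traces.1 h
      cases hs with
      | parLeft hp =>
        obtain ⟨φ, hφ, ψ, hψ, hi⟩ := ih hr
        exact ⟨_, cons_mem_traces.2 ⟨_, hp, hφ⟩, ψ, hψ, hi.left _⟩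
      | parRight hq =>
        obtain ⟨φ, hφ, ψ, hψ, hi⟩ := ih hr
        exact ⟨φ, hφ, _, cons_mem_traces.2 ⟨_, hq, hψ⟩, hi.right _⟩
      | comm hp hq =>
        obtain ⟨φ, hφ, ψ, hψ, hi⟩ := ih hr
        exact ⟨_, cons_mem_traces.2 ⟨_, hp, hφ⟩, _, cons_mem_traces.2 ⟨_, hq, hψ⟩, hi.comm _⟩
  · rintro ⟨φ, hφ, ψ, hψ, hi⟩
    induction hi generalizing p q with
    | nil => exact nil_mem_traces _
    | left μ _ ih =>
      obtain ⟨p', hp, hφ⟩ := cons_mem_traces.1 hφ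
      exact cons_mem_traces.2 ⟨_, .parLeft hp, ih hφ hψ⟩
    | right μ _ ih =>
      obtain ⟨q', hq, hψ⟩ := cons_mem_traces.1 hψ
      exact cons_mem_traces.2 ⟨_, .parRight hq, ih hφ hψ⟩
    | comm α _ ih =>
      obtain ⟨p', hp, hφ⟩ := cons_mem_traces.1 hφ
      obtain ⟨q', hq, hψ⟩ := cons_mem_traces.1 hψ
      exact cons_mem_traces.2 ⟨_, .comm hp hq, ih hφ hψ⟩

theorem traces_par_congr (hp : traces Step p = traces Step p')
    (hq : traces Step q = traces Step q') :
    traces Step (.par p q) = traces Step (.par p' q') := by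
  ext χ
  simp only [mem_traces_par, hp, hq]

theorem Interleave.append : ∀ φ ψ : List (Act A), Interleave φ ψ (φ ++ ψ)
  | [], [] => .nil
  | [], μ :: ψ => (Interleave.append [] ψ).right μ
  | μ :: φ, ψ => (Interleave.append φ ψ).left μ

theorem Interleave.eq_of_nil_right {φ ψ χ : List (Act A)} (h : Interleave φ ψ χ) (hψ : ψ = []) :
    χ = φ := by
  induction h with
  | nil => rfl
  | left μ _ ih => rw [ih hψ]
  | right => simp at hψ
  | comm => simp at hψ

theorem Interleave.symm {φ ψ χ : List (Act A)} (h : Interleave φ ψ χ) : Interleave ψ φ χ := by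
  induction h with
  | nil => exact .nil
  | left μ _ ih => exact ih.right μ
  | right μ _ ih => exact ih.left μ
  | comm α _ ih => cases α <;> exact ih.comm (Label.compl _)

theorem Interleave.mem_or_mem {φ ψ χ : List (Act A)} (h : Interleave φ ψ χ) {α : Label A}
    (hα : .vis α ∈ χ) : .vis α ∈ φ ∨ .vis α ∈ ψ := by
  induction h with
  | nil => simp at hα
  | left μ _ ih => simp only [List.mem_cons] at hα ⊢; tauto
  | right μ _ ih => simp only [List.mem_cons] at hα ⊢; tauto
  | comm β _ ih => simp at hα ⊢; tauto

theorem append_mem_traces_par {φ ψ : List (Act A)} (hφ : φ ∈ traces Step p)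
    (hψ : ψ ∈ traces Step q) : φ ++ ψ ∈ traces Step (.par p q) :=
  mem_traces_par.2 ⟨φ, hφ, ψ, hψ, .append φ ψ⟩

theorem traces_par_comm : traces Step (.par p q) = traces Step (.par q p) := by
  ext χ
  simp only [mem_traces_par]
  constructor
  · rintro ⟨φ, hφ, ψ, hψ, hi⟩
    exact ⟨ψ, hψ, φ, hφ, hi.symm⟩
  · rintro ⟨φ, hφ, ψ, hψ, hi⟩
    exact ⟨ψ, hψ, φ, hφ, hi.symm⟩

theorem traces_par_subset_left : traces Step p ⊆ traces Step (.par p q) := fun φ hφ => by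
  simpa using append_mem_traces_par hφ (nil_mem_traces q)

theorem traces_par_subset_right : traces Step q ⊆ traces Step (.par p q) := fun φ hφ => by
  simpa using append_mem_traces_par (nil_mem_traces p) hφ

theorem traces_par_of_inert_right (hq : Inert Step q) :
    traces Step (.par p q) = traces Step p := by
  refine subset_antisymm (fun χ h => ?_) traces_par_subset_left
  obtain ⟨φ, hφ, ψ, hψ, hi⟩ := mem_traces_par.1 h
  cases ψ with
  | nil => rwa [hi.eq_of_nil_right rfl]
  | cons μ ψ =>
    obtain ⟨q', hs, -⟩ := cons_mem_traces.1 hψ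
    exact (hq _ _ hs).elim

theorem traces_par_of_inert_left (hp : Inert Step p) :
    traces Step (.par p q) = traces Step q :=
  traces_par_comm.trans (traces_par_of_inert_right hp)

theorem inert_par_iff : Inert Step (.par p q) ↔ Inert Step p ∧ Inert Step q := by
  refine ⟨fun h => ⟨h.of_traces_subset traces_par_subset_left,
    h.of_traces_subset traces_par_subset_right⟩, fun ⟨hp, hq⟩ μ r h => ?_⟩
  cases h with
  | parLeft h => exact hp _ _ h
  | parRight h => exact hq _ _ h
  | comm h _ => exact hp _ _ h

/-! ### Congruence of the equivalence of futures -/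

theorem FutLE.pre (h : traces Step p = traces Step q) : FutLE Step (.pre μ p) (.pre μ q) := by
  intro ν r hr
  obtain ⟨rfl, rfl⟩ := step_pre_iff.1 hr
  exact ⟨q, .pre _ _, h⟩

theorem FutLE.plus (h : FutLE Step p q) (h' : FutLE Step p' q') :
    FutLE Step (.plus p p') (.plus q q') := by
  intro μ r hr
  cases hr with
  | plusLeft hr =>
    obtain ⟨s, hs, e⟩ := h _ _ hr
    exact ⟨s, .plusLeft hs, e⟩
  | plusRight hr =>
    obtain ⟨s, hs, e⟩ := h' _ _ hr
    exact ⟨s, .plusRight hs, e⟩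

/-- The component that does not move survives in the derivative, so its traces must agree exactly;
`FutLE` alone gives only inclusion. -/
theorem FutLE.par (h : FutLE Step p q) (h' : FutLE Step p' q')
    (e : traces Step p = traces Step q) (e' : traces Step p' = traces Step q') :
    FutLE Step (.par p p') (.par q q') := by
  intro μ r hr
  cases hr with
  | parLeft hr =>
    obtain ⟨s, hs, e₁⟩ := h _ _ hr
    exact ⟨_, .parLeft hs, traces_par_congr e₁ e'⟩
  | parRight hr =>
    obtain ⟨s, hs, e₁⟩ := h' _ _ hr
    exact ⟨_, .parRight hs, traces_par_congr e e₁⟩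
  | comm hr hr' =>
    obtain ⟨s, hs, e₁⟩ := h _ _ hr
    obtain ⟨s', hs', e₁'⟩ := h' _ _ hr'
    exact ⟨_, .comm hs hs', traces_par_congr e₁ e₁'⟩

theorem FutEquiv.pre (h : FutEquiv Step p q) : FutEquiv Step (.pre μ p) (.pre μ q) :=
  ⟨.pre h.traces_eq, .pre h.traces_eq.symm⟩

theorem FutEquiv.plus (h : FutEquiv Step p q) (h' : FutEquiv Step p' q') :
    FutEquiv Step (.plus p p') (.plus q q') :=
  ⟨h.1.plus h'.1, h.2.plus h'.2⟩

theorem FutEquiv.par (h : FutEquiv Step p q) (h' : FutEquiv Step p' q') :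
    FutEquiv Step (.par p p') (.par q q') :=
  ⟨h.1.par h'.1 h.traces_eq h'.traces_eq, h.2.par h'.2 h.symm.traces_eq h'.symm.traces_eq⟩

theorem FutLE.of_plus_left (h : FutLE Step (.plus p q) r) : FutLE Step p r :=
  fun _ _ hs => h _ _ (.plusLeft hs)

theorem FutLE.of_plus_right (h : FutLE Step (.plus p q) r) : FutLE Step q r :=
  fun _ _ hs => h _ _ (.plusRight hs)

theorem FutLE.of_par_left (hq : Inert Step q) (h : FutLE Step (.par p q) r) : FutLE Step p r := by
  intro μ p' hs
  obtain ⟨r', hr, e⟩ := h _ _ (.parLeft hs)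
  exact ⟨r', hr, (traces_par_of_inert_right hq).symm.trans e⟩

theorem FutLE.of_par_right (hp : Inert Step p) (h : FutLE Step (.par p q) r) :
    FutLE Step q r := by
  intro μ q' hs
  obtain ⟨r', hr, e⟩ := h _ _ (.parRight hs)
  exact ⟨r', hr, (traces_par_of_inert_left hp).symm.trans e⟩

/-! ### Parallel summands -/

/-- `p` has, up to inert parallel components, a summand `r ‖ s` or `s ‖ r` where `X` is the set
of traces of `r` and `Y` is the set of traces of `s`. -/
def HasParSummand (X Y : Set (List (Act A))) : Proc A → Prop
  | .nil => False
  | .var _ => False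
  | .pre _ _ => False
  | .plus p q => HasParSummand X Y p ∨ HasParSummand X Y q
  | .par p q => (traces Step p = X ∧ traces Step q = Y) ∨ (traces Step p = Y ∧ traces Step q = X) ∨
      (Inert Step q ∧ HasParSummand X Y p) ∨ (Inert Step p ∧ HasParSummand X Y q)

theorem HasParSummand.not_inert {X Y : Set (List (Act A))} {μ : Act A} (hX : [μ] ∈ X) :
    ∀ {p : Proc A}, HasParSummand X Y p → ¬ Inert Step p
  | .plus p q, h, hi => by
    rcases h with h | h
    · exact h.not_inert hX fun μ r hr => hi _ _ (.plusLeft hr)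
    · exact h.not_inert hX fun μ r hr => hi _ _ (.plusRight hr)
  | .par p q, h, hi => by
    rw [inert_par_iff] at hi
    rcases h with ⟨h, -⟩ | ⟨-, h⟩ | ⟨-, h⟩ | ⟨-, h⟩
    · obtain ⟨r, hr, -⟩ := cons_mem_traces.1 (h ▸ hX)
      exact hi.1 _ _ hr
    · obtain ⟨r, hr, -⟩ := cons_mem_traces.1 (h ▸ hX)
      exact hi.2 _ _ hr
    · exact h.not_inert hX hi.1
    · exact h.not_inert hX hi.2

end Traces

/-! ### Substitutions -/

section Subst

variable {A : Type*}

theorem subst_subst {V W U : Type*} (σ : V → Term A W) (ρ : W → Term A U) (t : Term A V) :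
    (t.subst σ).subst ρ = t.subst fun x => (σ x).subst ρ := by
  induction t with
  | nil => rfl
  | var => rfl
  | pre μ t ih => simp only [Term.subst, ih]
  | plus t u iht ihu => simp only [Term.subst, iht, ihu]
  | par t u iht ihu => simp only [Term.subst, iht, ihu]

theorem toTerm_subst {V : Type*} (p : Proc A) (σ : V → Proc A) : p.toTerm.subst σ = p := by
  rw [Proc.toTerm, subst_subst]
  induction p with
  | nil => rfl
  | var x => exact x.elim
  | pre μ t ih => simp only [Term.subst, ih]
  | plus t u iht ihu => simp only [Term.subst, iht, ihu]
  | par t u iht ihu => simp only [Term.subst, iht, ihu]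

/-- Either `x` does not occur in `t`, or each initial action of `σ x` occurs in a trace of
`t.subst σ`. -/
theorem subst_eq_or_mem_trace {V : Type*} (x : V) (t : Term A V) :
    (∀ σ ρ : V → Proc A, (∀ y, y ≠ x → σ y = ρ y) → t.subst σ = t.subst ρ) ∨
    (∀ (σ : V → Proc A) μ p, Step (σ x) μ p → ∃ φ ∈ traces Step (t.subst σ), μ ∈ φ) := by
  induction t with
  | nil => exact .inl fun _ _ _ => rfl
  | var y =>
    by_cases h : y = x
    · subst h
      exact .inr fun σ μ p hp => ⟨[μ], singleton_mem_traces hp, by simp⟩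
    · exact .inl fun σ ρ e => e y h
  | pre ν t ih =>
    refine ih.imp (fun h σ ρ e => by simp only [Term.subst, h σ ρ e]) fun h σ μ p hp => ?_
    obtain ⟨φ, hφ, hμ⟩ := h σ μ p hp
    exact ⟨ν :: φ, cons_mem_traces.2 ⟨_, .pre _ _, hφ⟩, by simp [hμ]⟩
  | plus t u iht ihu =>
    rcases iht with iht | iht
    · refine ihu.imp (fun h σ ρ e => by simp only [Term.subst, h σ ρ e, iht σ ρ e])
        fun h σ μ p hp => ?_
      obtain ⟨φ, hφ, hμ⟩ := h σ μ p hp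
      exact ⟨φ, FutLE.traces_subset (fun _ r hr => ⟨r, .plusRight hr, rfl⟩) hφ, hμ⟩
    · refine .inr fun σ μ p hp => ?_
      obtain ⟨φ, hφ, hμ⟩ := iht σ μ p hp
      exact ⟨φ, FutLE.traces_subset (fun _ r hr => ⟨r, .plusLeft hr, rfl⟩) hφ, hμ⟩
  | par t u iht ihu =>
    rcases iht with iht | iht
    · refine ihu.imp (fun h σ ρ e => by simp only [Term.subst, h σ ρ e, iht σ ρ e])
        fun h σ μ p hp => ?_
      obtain ⟨φ, hφ, hμ⟩ := h σ μ p hp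
      exact ⟨φ, traces_par_subset_right hφ, hμ⟩
    · refine .inr fun σ μ p hp => ?_
      obtain ⟨φ, hφ, hμ⟩ := iht σ μ p hp
      exact ⟨φ, traces_par_subset_left hφ, hμ⟩

/-- The substitution that adds a summand `τ` to the process substituted for `x`. -/
def addTau (σ : ℕ → Proc A) (x : ℕ) : ℕ → Proc A :=
  Function.update σ x (.plus (σ x) (.pre .tau .nil))

variable {σ : ℕ → Proc A} {x : ℕ} {t : Term A ℕ}

theorem addTau_self : addTau σ x x = .plus (σ x) (.pre .tau .nil) := Function.update_self ..

theorem addTau_of_ne {y : ℕ} (h : y ≠ x) : addTau σ x y = σ y := Function.update_of_ne h ..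

theorem step_addTau_self : Step (addTau σ x x) .tau .nil := by
  rw [addTau_self]
  exact .plusRight (.pre _ _)

/-- If some initial action of `σ x` does not occur in the traces of `t.subst σ`, then `t` does
not contain `x`. -/
theorem subst_addTau_of_not_mem {μ : Act A} {p : Proc A} (hx : Step (σ x) μ p)
    (h : ∀ φ ∈ traces Step (t.subst σ), μ ∉ φ) : t.subst (addTau σ x) = t.subst σ := by
  rcases subst_eq_or_mem_trace x t with ht | ht
  · exact ht _ _ fun y hy => addTau_of_ne hy
  · obtain ⟨φ, hφ, hμ⟩ := ht σ μ p hx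
    exact (h φ hφ hμ).elim

/-- An occurrence of `x` would expose the initial actions of `σ x` in a trace, but an inert process
has only the empty trace. -/
theorem subst_addTau_of_inert (hx : ¬ Inert Step (σ x)) (h : Inert Step (t.subst σ)) :
    t.subst (addTau σ x) = t.subst σ := by
  obtain ⟨μ, p, hp⟩ := exists_step_of_not_inert hx
  refine subst_addTau_of_not_mem hp fun φ hφ => ?_
  cases φ with
  | nil => simp
  | cons ν φ =>
    obtain ⟨q, hq, -⟩ := cons_mem_traces.1 hφ
    exact (h _ _ hq).elim

theorem subst_addTau_of_tau_not_mem
    (h : ∀ φ ∈ traces Step (t.subst (addTau σ x)), .tau ∉ φ) :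
    t.subst (addTau σ x) = t.subst σ := by
  rcases subst_eq_or_mem_trace x t with ht | ht
  · exact ht _ _ fun y hy => addTau_of_ne hy
  · obtain ⟨φ, hφ, hμ⟩ := ht (addTau σ x) .tau .nil step_addTau_self
    exact (h φ hφ hμ).elim

theorem subst_addTau_of_inert' (h : Inert Step (t.subst (addTau σ x))) :
    t.subst (addTau σ x) = t.subst σ := by
  refine subst_addTau_of_tau_not_mem fun φ hφ => ?_
  cases φ with
  | nil => simp
  | cons ν φ =>
    obtain ⟨q, hq, -⟩ := cons_mem_traces.1 hφ
    exact (h _ _ hq).elim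

/-- The new summand offers only `τ`. The derivatives may differ, since idle parallel components keep
the modified substitution. -/
theorem exists_step_vis_of_addTau {α : Label A} {p : Proc A}
    (h : Step (t.subst (addTau σ x)) (.vis α) p) : ∃ q, Step (t.subst σ) (.vis α) q := by
  induction t generalizing p with
  | nil => exact (not_step_nil h).elim
  | var y =>
    by_cases hy : y = x
    · subst hy
      rw [Term.subst, addTau_self, step_plus_iff, step_pre_iff] at h
      rcases h with h | ⟨h, -⟩
      · exact ⟨p, h⟩
      · cases h
    · rw [Term.subst, addTau_of_ne hy] at h
      exact ⟨p, h⟩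
  | pre μ t ih =>
    obtain ⟨rfl, -⟩ := step_pre_iff.1 h
    exact ⟨_, .pre _ _⟩
  | plus t u iht ihu =>
    rcases step_plus_iff.1 h with h | h
    · exact (iht h).imp fun _ h => .plusLeft h
    · exact (ihu h).imp fun _ h => .plusRight h
  | par t u iht ihu =>
    cases h with
    | parLeft h =>
      obtain ⟨q, hq⟩ := iht h
      exact ⟨_, .parLeft hq⟩
    | parRight h =>
      obtain ⟨q, hq⟩ := ihu h
      exact ⟨_, .parRight hq⟩

end Subst

/-! ### The processes `a ‖ p_N` -/

section Family

variable {A : Type*} {a b : A} {N : ℕ}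

theorem step_summation_iff {l : List (Proc A)} {μ : Act A} {q : Proc A} :
    Step (summation l) μ q ↔ ∃ p ∈ l, Step p μ q := by
  induction l with
  | nil => simp [summation, not_step_nil]
  | cons p l ih =>
    cases l with
    | nil => simp [summation]
    | cons p' l => rw [summation, step_plus_iff, ih]; simp

theorem powThen_succ (a b : A) (i : ℕ) : powThen a b (i + 1) = .pre (act b) (powThen a b i) :=
  Function.iterate_succ_apply' ..

theorem step_pSum_iff {μ : Act A} {q : Proc A} :
    Step (pSum a b N) μ q ↔ ∃ i < N, μ = act b ∧ q = powThen a b i := by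
  simp [pSum, step_summation_iff, powThen_succ, step_pre_iff]

theorem step_single_iff {μ : Act A} {q : Proc A} :
    Step (single a) μ q ↔ μ = act a ∧ q = .nil := step_pre_iff

theorem act_ne (h : a ≠ b) : act a ≠ act b := fun e => h (by simpa [act] using e)

theorem traces_single : traces Step (single a) = {[], [act a]} := by
  ext φ
  rcases φ with _ | ⟨μ, _ | ⟨ν, φ⟩⟩
  · simp [nil_mem_traces]
  · simp [cons_mem_traces, step_single_iff, nil_mem_traces]
  · simp [cons_mem_traces, step_single_iff, not_step_nil]

theorem mem_traces_powThen (i : ℕ) :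
    List.replicate i (act b) ++ [act a] ∈ traces Step (powThen a b i) := by
  induction i with
  | zero => exact singleton_mem_traces (.pre _ _)
  | succ i ih =>
    rw [powThen_succ]
    exact cons_mem_traces.2 ⟨_, .pre _ _, ih⟩

theorem mem_traces_pSum {i : ℕ} (hi : i < N) :
    act b :: (List.replicate i (act b) ++ [act a]) ∈ traces Step (pSum a b N) :=
  cons_mem_traces.2 ⟨_, step_pSum_iff.2 ⟨i, hi, rfl, rfl⟩, mem_traces_powThen i⟩

theorem eq_nil_of_mem_traces_powThen (hab : a ≠ b) {i : ℕ} {φ ψ : List (Act A)}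
    (h : φ ++ act a :: ψ ∈ traces Step (powThen a b i)) : ψ = [] := by
  induction i generalizing φ with
  | zero =>
    have h : φ ++ act a :: ψ ∈ traces Step (single a) := h
    rw [traces_single] at h
    rcases φ with _ | ⟨μ, φ⟩ <;> simp_all
  | succ i ih =>
    rw [powThen_succ] at h
    rcases φ with _ | ⟨μ, φ⟩
    · obtain ⟨q, hq, -⟩ := cons_mem_traces.1 h
      exact (act_ne hab (step_pre_iff.1 hq).1).elim
    · obtain ⟨q, hq, h⟩ := cons_mem_traces.1 h
      obtain ⟨-, rfl⟩ := step_pre_iff.1 hq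
      exact ih h

theorem eq_nil_of_mem_traces_pSum (hab : a ≠ b) {φ ψ : List (Act A)}
    (h : φ ++ act a :: ψ ∈ traces Step (pSum a b N)) : ψ = [] := by
  rcases φ with _ | ⟨μ, φ⟩ <;> obtain ⟨q, hq, h⟩ := cons_mem_traces.1 h <;>
    obtain ⟨i, -, hμ, rfl⟩ := step_pSum_iff.1 hq
  · exact (act_ne hab hμ).elim
  · exact eq_nil_of_mem_traces_powThen hab h

theorem step_eLHS {μ : Act A} {q : Proc A} (h : Step (eLHS a b N) μ q) :
    (μ = act a ∧ q = .par .nil (pSum a b N)) ∨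
    ∃ i < N, μ = act b ∧ q = .par (single a) (powThen a b i) := by
  cases h with
  | parLeft h =>
    obtain ⟨rfl, rfl⟩ := step_single_iff.1 h
    exact .inl ⟨rfl, rfl⟩
  | parRight h =>
    obtain ⟨i, hi, rfl, rfl⟩ := step_pSum_iff.1 h
    exact .inr ⟨i, hi, rfl, rfl⟩
  -- Both components start with names only, so they cannot synchronise.
  | comm h h' =>
    obtain ⟨h, -⟩ := step_single_iff.1 h
    obtain ⟨i, -, h', -⟩ := step_pSum_iff.1 h'
    simp only [act, Act.vis.injEq] at h h'
    simp [h, Label.compl] at h'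

/-- The second `a` can occur only once all `k` copies of `b` are done. A single `a` would not
determine `k`, as the left component may perform it at any time. -/
theorem eq_of_mem_traces_par_powThen (hab : a ≠ b) {i k : ℕ}
    (h : List.replicate i (act b) ++ [act a, act a] ∈
      traces Step (.par (single a) (powThen a b k))) : i = k := by
  have hba := act_ne hab.symm
  induction i generalizing k with
  | zero =>
    cases k with
    | zero => rfl
    | succ k =>
      rw [powThen_succ] at h
      obtain ⟨q, hq, h⟩ := cons_mem_traces.1 h
      have hq' : q = .par .nil (.pre (act b) (powThen a b k)) := by
        cases hq with
        | parLeft hs => rw [(step_single_iff.1 hs).2]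
        | parRight hs => exact (hba (step_pre_iff.1 hs).1.symm).elim
      rw [hq', traces_par_of_inert_left inert_nil] at h
      obtain ⟨q, hq, -⟩ := cons_mem_traces.1 h
      exact (hba (step_pre_iff.1 hq).1.symm).elim
  | succ i ih =>
    obtain ⟨q, hq, h⟩ := cons_mem_traces.1 h
    cases hq with
    | parLeft hs => exact (hba (step_single_iff.1 hs).1).elim
    | parRight hs =>
      cases k with
      | zero => exact (hba (step_single_iff.1 hs).1).elim
      | succ k =>
        rw [powThen_succ] at hs
        obtain ⟨-, rfl⟩ := step_pre_iff.1 hs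
        rw [ih h]

theorem FutLE.act_eq {p q : Proc A} {μ : Act A} (h : FutLE Step p (eLHS a b N))
    (hs : Step p μ q) : μ = act a ∨ μ = act b := by
  obtain ⟨q', hq, -⟩ := h _ _ hs
  rcases step_eLHS hq with ⟨h, -⟩ | ⟨i, -, h, -⟩
  · exact .inl h
  · exact .inr h

theorem FutLE.not_step_tau {p q : Proc A} (h : FutLE Step p (eLHS a b N)) :
    ¬ Step p .tau q := fun hs => by
  rcases h.act_eq hs with h | h <;> cases h

theorem FutLE.traces_eq_pSum (hab : a ≠ b) {p q : Proc A} (h : FutLE Step p (eLHS a b N))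
    (hs : Step p (act a) q) : traces Step q = traces Step (pSum a b N) := by
  obtain ⟨q', hq, e⟩ := h _ _ hs
  rcases step_eLHS hq with ⟨-, rfl⟩ | ⟨i, -, h, -⟩
  · rw [e, traces_par_of_inert_left inert_nil]
  · exact (act_ne hab h).elim

theorem FutLE.eq_of_mem_traces (hab : a ≠ b) {p q : Proc A} (h : FutLE Step p (eLHS a b N))
    (hs : Step p (act b) q) {i j : ℕ}
    (hi : List.replicate i (act b) ++ [act a, act a] ∈ traces Step q)
    (hj : List.replicate j (act b) ++ [act a, act a] ∈ traces Step q) : i = j := by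
  obtain ⟨q', hq, e⟩ := h _ _ hs
  rcases step_eLHS hq with ⟨h, -⟩ | ⟨k, -, -, rfl⟩
  · exact (act_ne hab.symm h).elim
  · rw [e] at hi hj
    rw [eq_of_mem_traces_par_powThen hab hi, eq_of_mem_traces_par_powThen hab hj]

theorem FutLE.not_step_comm {p q p' q' : Proc A} {α : Label A}
    (h : FutLE Step (.par p q) (eLHS a b N)) (hp : Step p (.vis α) p') :
    ¬ Step q (.vis α.compl) q' :=
  fun hq => h.not_step_tau (.comm hp hq)

theorem FutLE.par_comm (p q : Proc A) : FutLE Step (.par p q) (.par q p) := by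
  intro μ r hr
  cases hr with
  | parLeft h => exact ⟨_, .parRight h, traces_par_comm⟩
  | parRight h => exact ⟨_, .parLeft h, traces_par_comm⟩
  | @comm _ _ p' q' α h h' =>
    refine ⟨.par q' p', .comm h' ?_, traces_par_comm⟩
    cases α <;> exact h

/-- In traces of `p_N` nothing follows an `a`, yet any action of `q` could be performed after `φ`.
-/
theorem inert_of_traces_par_subset_left (hab : a ≠ b) {p q : Proc A}
    (h : traces Step (.par p q) ⊆ traces Step (pSum a b N)) {φ : List (Act A)}
    (hφ : φ ∈ traces Step p) (ha : act a ∈ φ) : Inert Step q := by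
  intro μ q' hq
  obtain ⟨φ₁, φ₂, rfl⟩ := List.append_of_mem ha
  have := h (append_mem_traces_par hφ (singleton_mem_traces hq))
  rw [List.append_assoc, List.cons_append] at this
  simpa using eq_nil_of_mem_traces_pSum hab this

theorem inert_or_inert_of_traces_par_subset (hab : a ≠ b) {p q : Proc A}
    (h : traces Step (.par p q) ⊆ traces Step (pSum a b N)) {φ : List (Act A)}
    (hφ : φ ∈ traces Step (.par p q)) (ha : act a ∈ φ) : Inert Step p ∨ Inert Step q := by
  obtain ⟨φ₁, h₁, φ₂, h₂, hi⟩ := mem_traces_par.1 hφ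
  rcases hi.mem_or_mem ha with ha | ha
  · exact .inr (inert_of_traces_par_subset_left hab h h₁ ha)
  · exact .inl (inert_of_traces_par_subset_left hab (traces_par_comm.symm.subset.trans h) h₂ ha)

end Family

/-! ### Small terms -/

section Small

variable {A : Type*} {a b : A} {N : ℕ} {σ : ℕ → Proc A}

/-- The terms that occur in `t` directly below a prefix, not itself below a prefix. -/
def prefixBodies {V : Type*} : Term A V → List (Term A V)
  | .nil => []
  | .var _ => []
  | .pre _ t => [t]
  | .plus t u => prefixBodies t ++ prefixBodies u
  | .par t u => prefixBodies t ++ prefixBodies u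

/-- A `b`-step originates at an exposed prefix or at an exposed variable. Parallel companions of the
moving part are inert because of the `a` in the trace, hence do not contain `x` and stay inert after
the modification. -/
theorem exists_step_addTau_or_traces_eq (hab : a ≠ b) {t : Term A ℕ}
    (h : traces Step (t.subst σ) ⊆ traces Step (pSum a b N)) {q : Proc A}
    (hq : Step (t.subst σ) (act b) q) {φ : List (Act A)} (hφ : φ ∈ traces Step q)
    (ha : act a ∈ φ) :
    (∃ x r s, Step (σ x) (act b) r ∧ Step (t.subst (addTau σ x)) .tau s ∧ Inert Step s) ∨
    ∃ v ∈ prefixBodies t, traces Step q = traces Step (v.subst σ) := by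
  have haφ : act a ∈ act b :: φ := List.mem_cons_of_mem _ ha
  induction t generalizing q with
  | nil => exact (not_step_nil hq).elim
  | var x => exact .inl ⟨x, q, .nil, hq, step_addTau_self, inert_nil⟩
  | pre μ t ih =>
    obtain ⟨-, rfl⟩ := step_pre_iff.1 hq
    exact .inr ⟨t, by simp [prefixBodies], rfl⟩
  | plus t u iht ihu =>
    rcases step_plus_iff.1 hq with hq | hq
    · have h' := (FutLE.refl (step := Step) _).of_plus_left.traces_subset.trans h
      rcases iht h' hq hφ with ⟨x, r, s, hr, hs, hi⟩ | ⟨v, hv, e⟩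
      · exact .inl ⟨x, r, s, hr, .plusLeft hs, hi⟩
      · exact .inr ⟨v, List.mem_append_left _ hv, e⟩
    · have h' := (FutLE.refl (step := Step) _).of_plus_right.traces_subset.trans h
      rcases ihu h' hq hφ with ⟨x, r, s, hr, hs, hi⟩ | ⟨v, hv, e⟩
      · exact .inl ⟨x, r, s, hr, .plusRight hs, hi⟩
      · exact .inr ⟨v, List.mem_append_right _ hv, e⟩
  | par t u iht ihu =>
    have hin := inert_or_inert_of_traces_par_subset hab h (cons_mem_traces.2 ⟨_, hq, hφ⟩) haφ
    cases hq with
    | parLeft hq =>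
      have hu := hin.resolve_left fun hi => hi _ _ hq
      rw [traces_par_of_inert_right hu] at hφ ⊢
      rcases iht (traces_par_subset_left.trans h) hq hφ with ⟨x, r, s, hr, hs, hi⟩ | ⟨v, hv, e⟩
      · refine .inl ⟨x, r, _, hr, .parLeft hs, inert_par_iff.2 ⟨hi, ?_⟩⟩
        rwa [subst_addTau_of_inert (fun hi => hi _ _ hr) hu]
      · exact .inr ⟨v, List.mem_append_left _ hv, e⟩
    | parRight hq =>
      have ht := hin.resolve_right fun hi => hi _ _ hq
      rw [traces_par_of_inert_left ht] at hφ ⊢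
      rcases ihu (traces_par_subset_right.trans h) hq hφ with ⟨x, r, s, hr, hs, hi⟩ | ⟨v, hv, e⟩
      · refine .inl ⟨x, r, _, hr, .parRight hs, inert_par_iff.2 ⟨?_, hi⟩⟩
        rwa [subst_addTau_of_inert (fun hi => hi _ _ hr) ht]
      · exact .inr ⟨v, List.mem_append_right _ hv, e⟩

theorem exists_step_addTau_of_traces_eq_pSum (hab : a ≠ b) {t u : Term A ℕ}
    (h : FutLE Step (.par (t.subst σ) (u.subst σ)) (eLHS a b N))
    (ht : traces Step (t.subst σ) = {[], [act a]})
    (hu : traces Step (u.subst σ) = traces Step (pSum a b N))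
    (hN : (prefixBodies u).length < N) :
    ∃ x r s, Step (σ x) (act b) r ∧ Step (u.subst (addTau σ x)) .tau s ∧ Inert Step s ∧
      t.subst (addTau σ x) = t.subst σ := by
  suffices H : ∃ x r s, Step (σ x) (act b) r ∧ Step (u.subst (addTau σ x)) .tau s ∧
      Inert Step s by
    obtain ⟨x, r, s, hr, hs, hi⟩ := H
    refine ⟨x, r, s, hr, hs, hi, subst_addTau_of_not_mem hr fun φ hφ => ?_⟩
    rw [ht] at hφ
    rcases hφ with rfl | rfl
    · simp
    · simpa using act_ne hab.symm
  -- Without such a variable, every `b`-derivative leading to an `a` is trace equivalent to an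
  -- instance of a prefix body, and there are too few of these.
  by_contra hno
  have step_b : ∀ i : Fin N, ∃ v ∈ prefixBodies u, ∃ q, Step (u.subst σ) (act b) q ∧
      List.replicate i (act b) ++ [act a] ∈ traces Step q ∧
      traces Step q = traces Step (v.subst σ) := by
    intro i
    obtain ⟨q, hq, hi⟩ := cons_mem_traces.1 (hu.symm ▸ mem_traces_pSum (a := a) (b := b) i.2)
    obtain ⟨v, hv, e⟩ :=
      (exists_step_addTau_or_traces_eq hab hu.subset hq hi (by simp)).resolve_left hno
    exact ⟨v, hv, q, hq, hi, e⟩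
  choose v hv q hq hi e using step_b
  -- The hypothesis on futures concerns the composition, so the `a` of the other component is
  -- appended to obtain the traces that identify the index.
  have aa_mem : ∀ i j, List.replicate j (act b) ++ [act a] ∈ traces Step (q i) →
      List.replicate j (act b) ++ [act a, act a] ∈
        traces Step (.par (t.subst σ) (q i)) := by
    intro i j hj
    rw [traces_par_comm]
    simpa using append_mem_traces_par hj (show [act a] ∈ traces Step (t.subst σ) by simp [ht])
  have inj : Function.Injective v := by
    intro i j hij
    have e' : traces Step (q i) = traces Step (q j) := by rw [e, e, hij]
    exact Fin.ext (h.eq_of_mem_traces hab (.parRight (hq i)) (aa_mem i i (hi i))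
      (aa_mem i j (e'.symm ▸ hi j)))
  classical
  have hcard : (Finset.univ : Finset (Fin N)).card ≤ (prefixBodies u).toFinset.card :=
    Finset.card_le_card_of_injOn v (fun i _ => by simpa using hv i) inj.injOn
  rw [Finset.card_univ, Fintype.card_fin] at hcard
  exact absurd (hcard.trans (List.toFinset_card_le _)) (by omega)

/-- The first alternative arises when `x` itself supplies the summand, the second when `x` only
contributes to the `p_N` component, so that the `a` component is left over. -/
theorem exists_step_addTau_of_hasParSummand (hab : a ≠ b) {t : Term A ℕ}
    (h : FutLE Step (t.subst σ) (eLHS a b N))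
    (hQ : HasParSummand {[], [act a]} (traces Step (pSum a b N)) (t.subst σ))
    (hN : (prefixBodies t).length < N) :
    ∃ x s, ¬ Inert Step (σ x) ∧ Step (t.subst (addTau σ x)) .tau s ∧
      ((Inert Step s ∧ HasParSummand {[], [act a]} (traces Step (pSum a b N)) (σ x)) ∨
        traces Step s = {[], [act a]}) := by
  induction t with
  | nil => exact hQ.elim
  | var x =>
    exact ⟨x, .nil, hQ.not_inert (μ := act a) (by simp), step_addTau_self, .inl ⟨inert_nil, hQ⟩⟩
  | pre => exact hQ.elim
  | plus t u iht ihu =>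
    rw [prefixBodies, List.length_append] at hN
    rcases hQ with hQ | hQ
    · obtain ⟨x, s, hx, hs, H⟩ := iht h.of_plus_left hQ (by omega)
      exact ⟨x, s, hx, .plusLeft hs, H⟩
    · obtain ⟨x, s, hx, hs, H⟩ := ihu h.of_plus_right hQ (by omega)
      exact ⟨x, s, hx, .plusRight hs, H⟩
  | par t u iht ihu =>
    rw [prefixBodies, List.length_append] at hN
    rcases hQ with ⟨ht, hu⟩ | ⟨ht, hu⟩ | ⟨hu, hQ⟩ | ⟨ht, hQ⟩
    · obtain ⟨x, r, s, hr, hs, hi, e⟩ :=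
        exists_step_addTau_of_traces_eq_pSum hab h ht hu (by omega)
      refine ⟨x, _, fun hi => hi _ _ hr, .parRight hs, .inr ?_⟩
      rw [traces_par_of_inert_right hi, e, ht]
    · obtain ⟨x, r, s, hr, hs, hi, e⟩ :=
        exists_step_addTau_of_traces_eq_pSum hab ((FutLE.par_comm _ _).trans h) hu ht (by omega)
      refine ⟨x, _, fun hi => hi _ _ hr, .parLeft hs, .inr ?_⟩
      rw [traces_par_of_inert_left hi, e, hu]
    · obtain ⟨x, s, hx, hs, H⟩ := iht (h.of_par_left hu) hQ (by omega)
      have hu' : Inert Step (u.subst (addTau σ x)) := by rwa [subst_addTau_of_inert hx hu]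
      refine ⟨x, _, hx, .parLeft hs, ?_⟩
      rwa [traces_par_of_inert_right hu', inert_par_iff, and_iff_left hu']
    · obtain ⟨x, s, hx, hs, H⟩ := ihu (h.of_par_right ht) hQ (by omega)
      have ht' : Inert Step (t.subst (addTau σ x)) := by rwa [subst_addTau_of_inert hx ht]
      refine ⟨x, _, hx, .parRight hs, ?_⟩
      rwa [traces_par_of_inert_left ht', inert_par_iff, and_iff_right ht']

theorem not_step_comm_addTau {t u : Term A ℕ} {x : ℕ} {α : Label A} {p q : Proc A}
    (h : FutLE Step (.par (t.subst σ) (u.subst σ)) (eLHS a b N))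
    (hp : Step (t.subst (addTau σ x)) (.vis α) p) :
    ¬ Step (u.subst (addTau σ x)) (.vis α.compl) q := fun hq => by
  obtain ⟨p', hp'⟩ := exists_step_vis_of_addTau hp
  obtain ⟨q', hq'⟩ := exists_step_vis_of_addTau hq
  exact h.not_step_comm hp' hq'

/-- The `τ` can only come from the new summand of `x`. The residue being inert, so is everything
parallel to that occurrence, and the summand of `σ x` is inherited. -/
theorem hasParSummand_of_step_addTau_inert {Y : Set (List (Act A))} {t : Term A ℕ} {x : ℕ}
    {s : Proc A} (h : FutLE Step (t.subst σ) (eLHS a b N))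
    (hs : Step (t.subst (addTau σ x)) .tau s) (hi : Inert Step s)
    (hQ : HasParSummand {[], [act a]} Y (σ x)) :
    HasParSummand {[], [act a]} Y (t.subst σ) := by
  induction t generalizing s with
  | nil => exact (not_step_nil hs).elim
  | var y =>
    by_cases hy : y = x
    · subst hy
      exact hQ
    · rw [Term.subst, addTau_of_ne hy] at hs
      exact (h.not_step_tau hs).elim
  | pre μ t ih =>
    obtain ⟨rfl, -⟩ := step_pre_iff.1 hs
    exact (h.not_step_tau (.pre _ _)).elim
  | plus t u iht ihu =>
    rcases step_plus_iff.1 hs with hs | hs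
    · exact .inl (iht h.of_plus_left hs hi)
    · exact .inr (ihu h.of_plus_right hs hi)
  | par t u iht ihu =>
    cases hs with
    | parLeft hs =>
      obtain ⟨hi, hu⟩ := inert_par_iff.1 hi
      rw [subst_addTau_of_inert' hu] at hu
      exact .inr (.inr (.inl ⟨hu, iht (h.of_par_left hu) hs hi⟩))
    | parRight hs =>
      obtain ⟨ht, hi⟩ := inert_par_iff.1 hi
      rw [subst_addTau_of_inert' ht] at ht
      exact .inr (.inr (.inr ⟨ht, ihu (h.of_par_right ht) hs hi⟩))
    | comm hp hq => exact (not_step_comm_addTau h hp hq).elim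

theorem traces_par_eq_single {p q : Proc A} (h : traces Step (.par p q) = {[], [act a]}) :
    (Inert Step p ∧ traces Step q = {[], [act a]}) ∨
    (Inert Step q ∧ traces Step p = {[], [act a]}) := by
  by_cases hp : Inert Step p
  · exact .inl ⟨hp, by rwa [traces_par_of_inert_left hp] at h⟩
  by_cases hq : Inert Step q
  · exact .inr ⟨hq, by rwa [traces_par_of_inert_right hq] at h⟩
  obtain ⟨μ, p', hp⟩ := exists_step_of_not_inert hp
  obtain ⟨ν, q', hq⟩ := exists_step_of_not_inert hq
  have := append_mem_traces_par (singleton_mem_traces hp) (singleton_mem_traces hq)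
  simp [h] at this

theorem exists_step_inert_of_traces_eq {p : Proc A} (h : traces Step p = {[], [act a]}) :
    ∃ q, Step p (act a) q ∧ Inert Step q := by
  obtain ⟨q, hq, -⟩ := cons_mem_traces.1 (show [act a] ∈ traces Step p by simp [h])
  refine ⟨q, hq, fun μ r hr => ?_⟩
  have : [act a, μ] ∈ traces Step p := cons_mem_traces.2 ⟨q, hq, singleton_mem_traces hr⟩
  simp [h] at this

/-- The `τ` of `x` leaves `0`, so the `a` remains in some parallel companion. That companion does
not contain `x`; once it has performed its `a` it is inert, and the rest must trace like the only
`a`-derivative of `a ‖ p_N`. -/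
theorem hasParSummand_of_step_addTau (hab : a ≠ b) {t : Term A ℕ} {x : ℕ} {s : Proc A}
    (h : FutLE Step (t.subst σ) (eLHS a b N))
    (hs : Step (t.subst (addTau σ x)) .tau s) (hX : traces Step s = {[], [act a]}) :
    HasParSummand {[], [act a]} (traces Step (pSum a b N)) (t.subst σ) := by
  have no_tau : ∀ {u : Term A ℕ}, traces Step (u.subst (addTau σ x)) = {[], [act a]} →
      u.subst (addTau σ x) = u.subst σ := by
    intro u hu
    refine subst_addTau_of_tau_not_mem fun φ hφ => ?_
    rw [hu] at hφ
    rcases hφ with rfl | rfl <;> simp [act]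
  induction t generalizing s with
  | nil => exact (not_step_nil hs).elim
  | var y =>
    by_cases hy : y = x
    · subst hy
      rw [Term.subst, addTau_self, step_plus_iff, step_pre_iff] at hs
      rcases hs with hs | ⟨-, rfl⟩
      · exact (h.not_step_tau hs).elim
      · obtain ⟨q, hq, -⟩ := exists_step_inert_of_traces_eq hX
        exact (not_step_nil hq).elim
    · rw [Term.subst, addTau_of_ne hy] at hs
      exact (h.not_step_tau hs).elim
  | pre μ t ih =>
    obtain ⟨rfl, -⟩ := step_pre_iff.1 hs
    exact (h.not_step_tau (.pre _ _)).elim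
  | plus t u iht ihu =>
    rcases step_plus_iff.1 hs with hs | hs
    · exact .inl (iht h.of_plus_left hs hX)
    · exact .inr (ihu h.of_plus_right hs hX)
  | par t u iht ihu =>
    cases hs with
    | parLeft hs =>
      rcases traces_par_eq_single hX with ⟨-, hu⟩ | ⟨hu, hX⟩
      · rw [no_tau hu] at hu
        obtain ⟨q, hq, hi⟩ := exists_step_inert_of_traces_eq hu
        have e := h.traces_eq_pSum hab (.parRight hq)
        rw [traces_par_of_inert_right hi] at e
        exact .inr (.inl ⟨e, hu⟩)
      · rw [subst_addTau_of_inert' hu] at hu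
        exact .inr (.inr (.inl ⟨hu, iht (h.of_par_left hu) hs hX⟩))
    | parRight hs =>
      rcases traces_par_eq_single hX with ⟨ht, hX⟩ | ⟨-, ht⟩
      · rw [subst_addTau_of_inert' ht] at ht
        exact .inr (.inr (.inr ⟨ht, ihu (h.of_par_right ht) hs hX⟩))
      · rw [no_tau ht] at ht
        obtain ⟨q, hq, hi⟩ := exists_step_inert_of_traces_eq ht
        have e := h.traces_eq_pSum hab (.parLeft hq)
        rw [traces_par_of_inert_left hi] at e
        exact .inl ⟨ht, e⟩
    | comm hp hq => exact (not_step_comm_addTau h hp hq).elim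

theorem SoundEq.hasParSummand (hab : a ≠ b) {t u : Term A ℕ}
    (hsound : SoundEq (FutEquiv Step) (t, u)) (h : FutLE Step (t.subst σ) (eLHS a b N))
    (hQ : HasParSummand {[], [act a]} (traces Step (pSum a b N)) (t.subst σ))
    (hN : (prefixBodies t).length < N) :
    HasParSummand {[], [act a]} (traces Step (pSum a b N)) (u.subst σ) := by
  obtain ⟨x, s, -, hs, H⟩ := exists_step_addTau_of_hasParSummand hab h hQ hN
  have hu : FutLE Step (u.subst σ) (eLHS a b N) := (hsound σ).2.trans h
  obtain ⟨s', hs', e⟩ := (hsound (addTau σ x)).1 _ _ hs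
  rcases H with ⟨hi, hx⟩ | hX
  · exact hasParSummand_of_step_addTau_inert hu hs' ((inert_congr e).1 hi) hx
  · exact hasParSummand_of_step_addTau hab hu hs' (e ▸ hX)

/-! ### Derivations -/

/-- The hypothesis is `FutLE` rather than `FutEquiv` because only the former passes to summands. It
passes to a parallel component only beside an inert one, which is how `HasParSummand` recurses. -/
theorem Derivable.futEquiv_and_hasParSummand_iff (hab : a ≠ b) {E : Set (Equation A)}
    (hE : Sound (FutEquiv Step) E)
    (hN : ∀ e ∈ E, (prefixBodies e.1).length < N ∧ (prefixBodies e.2).length < N)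
    {t u : Term A ℕ} (h : Derivable E t u) (σ : ℕ → Proc A) :
    FutEquiv Step (t.subst σ) (u.subst σ) ∧
    (FutLE Step (t.subst σ) (eLHS a b N) →
      (HasParSummand {[], [act a]} (traces Step (pSum a b N)) (t.subst σ) ↔
        HasParSummand {[], [act a]} (traces Step (pSum a b N)) (u.subst σ))) := by
  induction h generalizing σ with
  | @ax t u h =>
    refine ⟨hE _ h σ, fun ht => ⟨fun hQ => ?_, fun hQ => ?_⟩⟩
    · exact (hE _ h).hasParSummand hab ht hQ (hN _ h).1
    · exact SoundEq.hasParSummand (t := u) (u := t) hab (fun σ => (hE _ h σ).symm)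
        ((hE _ h σ).2.trans ht) hQ (hN _ h).2
  | refl t => exact ⟨⟨.refl _, .refl _⟩, fun _ => Iff.rfl⟩
  | symm _ ih => exact ⟨(ih σ).1.symm, fun h => ((ih σ).2 ((ih σ).1.1.trans h)).symm⟩
  | trans _ _ ih₁ ih₂ =>
    obtain ⟨e₁, h₁⟩ := ih₁ σ
    obtain ⟨e₂, h₂⟩ := ih₂ σ
    exact ⟨⟨e₁.1.trans e₂.1, e₂.2.trans e₁.2⟩, fun h => (h₁ h).trans (h₂ (e₁.2.trans h))⟩
  | subst ρ _ ih =>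
    simp only [subst_subst]
    exact ih _
  | pre μ _ ih => exact ⟨(ih σ).1.pre, fun _ => Iff.rfl⟩
  | plus _ _ ih₁ ih₂ =>
    exact ⟨(ih₁ σ).1.plus (ih₂ σ).1, fun h =>
      or_congr ((ih₁ σ).2 h.of_plus_left) ((ih₂ σ).2 h.of_plus_right)⟩
  | par _ _ ih₁ ih₂ =>
    obtain ⟨e₁, h₁⟩ := ih₁ σ
    obtain ⟨e₂, h₂⟩ := ih₂ σ
    refine ⟨e₁.par e₂, fun h => ?_⟩
    simp only [Term.subst, HasParSummand, ← e₁.traces_eq, ← e₂.traces_eq,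
      ← inert_congr e₁.traces_eq, ← inert_congr e₂.traces_eq]
    refine or_congr Iff.rfl (or_congr Iff.rfl (or_congr ?_ ?_))
    · exact and_congr_right fun hi => h₁ (h.of_par_left hi)
    · exact and_congr_right fun hi => h₂ (h.of_par_right hi)
  | plusComm t u =>
    exact ⟨⟨fun _ r hr => ⟨r, step_plus_iff.2 (step_plus_iff.1 hr).symm, rfl⟩,
      fun _ r hr => ⟨r, step_plus_iff.2 (step_plus_iff.1 hr).symm, rfl⟩⟩, fun _ => or_comm⟩
  | plusAssoc t u v =>
    refine ⟨⟨fun _ r hr => ⟨r, ?_, rfl⟩, fun _ r hr => ⟨r, ?_, rfl⟩⟩, fun _ => or_assoc⟩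
    · simpa only [Term.subst, step_plus_iff, or_assoc] using hr
    · simpa only [Term.subst, step_plus_iff, or_assoc] using hr

theorem not_hasParSummand_summation {X Y : Set (List (Act A))} {l : List (Proc A)}
    (h : ∀ p ∈ l, ¬ HasParSummand X Y p) : ¬ HasParSummand X Y (summation l) := by
  induction l with
  | nil => exact id
  | cons p l ih =>
    cases l with
    | nil => exact h p (by simp)
    | cons p' l =>
      rintro (hp | hp)
      · exact h p (by simp) hp
      · exact ih (fun q hq => h q (List.mem_cons_of_mem _ hq)) hp

theorem not_derivable_eEq (hab : a ≠ b) {E : Set (Equation A)}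
    (hE : Sound (PFEquiv Step) E)
    (hN : ∀ e ∈ E, (prefixBodies e.1).length < N ∧ (prefixBodies e.2).length < N) :
    ¬ Derivable E (eEq a b N).1 (eEq a b N).2 := by
  intro h
  have H := (h.futEquiv_and_hasParSummand_iff hab
    (fun e he σ => (hE e he σ).futEquiv) hN fun _ => .nil).2
  simp only [eEq, toTerm_subst] at H
  -- The left side is itself the required composition; the summands of the right side are all
  -- prefixes.
  rcases (H (.refl _)).1 (.inl ⟨traces_single, rfl⟩) with h | h
  · exact h
  · refine not_hasParSummand_summation (fun p hp => ?_) h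
    obtain ⟨j, -, rfl⟩ := List.mem_map.1 hp
    exact id

theorem exists_forall_not_derivable_eEq (hab : a ≠ b) {E : Set (Equation A)} (hfin : E.Finite)
    (hE : Sound (PFEquiv Step) E) :
    ∃ N₀ : ℕ, ∀ N : ℕ, N₀ ≤ N → ¬ Derivable E (eEq a b N).1 (eEq a b N).2 := by
  obtain ⟨M, hM⟩ := (hfin.image fun e =>
    (prefixBodies e.1).length + (prefixBodies e.2).length).bddAbove
  refine ⟨M + 1, fun N hN => not_derivable_eEq hab hE fun e he => ?_⟩
  have := hM ⟨e, he, rfl⟩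
  simp only at this
  omega

/-! ### Soundness of `e_N` modulo bisimilarity -/

theorem step_eRHS_iff {μ : Act A} {q : Proc A} : Step (eRHS a b N) μ q ↔
    (μ = act a ∧ q = pSum a b N) ∨
    ∃ i < N, μ = act b ∧ q = .par (single a) (powThen a b i) := by
  simp [eRHS, step_plus_iff, step_pre_iff, step_summation_iff]

theorem bisimilar_eLHS_eRHS (a b : A) (N : ℕ) :
    Bisimilar Step (eLHS a b N) (eRHS a b N) := by
  -- The last two disjuncts absorb the idle `0` left beside `p_N` after the `a`.
  refine ⟨fun p q => p = q ∨ (p = eLHS a b N ∧ q = eRHS a b N) ∨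
    (p = eRHS a b N ∧ q = eLHS a b N) ∨ q = .par .nil p ∨ p = .par .nil q,
    fun p q => ?_, ?_, .inr (.inl ⟨rfl, rfl⟩)⟩
  · rintro (rfl | h | h | h | h) <;> tauto
  · rintro p q (rfl | ⟨rfl, rfl⟩ | ⟨rfl, rfl⟩ | rfl | rfl) μ p' hp
    · exact ⟨p', hp, .inl rfl⟩
    · rcases step_eLHS hp with ⟨rfl, rfl⟩ | ⟨i, hi, rfl, rfl⟩
      · exact ⟨_, step_eRHS_iff.2 (.inl ⟨rfl, rfl⟩), by simp⟩
      · exact ⟨_, step_eRHS_iff.2 (.inr ⟨i, hi, rfl, rfl⟩), .inl rfl⟩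
    · rcases step_eRHS_iff.1 hp with ⟨rfl, rfl⟩ | ⟨i, hi, rfl, rfl⟩
      · exact ⟨_, .parLeft (.pre _ _), by simp⟩
      · exact ⟨_, .parRight (step_pSum_iff.2 ⟨i, hi, rfl, rfl⟩), .inl rfl⟩
    · exact ⟨_, .parRight hp, by simp⟩
    · cases hp with
      | parLeft h => exact (not_step_nil h).elim
      | parRight h => exact ⟨_, h, by simp⟩
      | comm h _ => exact (not_step_nil h).elim

theorem not_hasFiniteGroundCompleteAxiomatisation [Nontrivial A] {rel : Proc A → Proc A → Prop}
    (h : ∀ p q, Bisimilar Step p q → rel p q) (h' : ∀ p q, rel p q → PFEquiv Step p q) :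
    ¬ HasFiniteGroundCompleteAxiomatisation rel := by
  rintro ⟨E, hfin, hsound, hcomplete⟩
  obtain ⟨a, b, hab⟩ := exists_pair_ne A
  obtain ⟨N, hN⟩ := exists_forall_not_derivable_eEq hab hfin fun e he σ => h' _ _ (hsound e he σ)
  exact hN N le_rfl (hcomplete _ _ (h _ _ (bisimilar_eLHS_eRHS a b N)))

end Small

end CCS

theorem mainTheorem9 {A : Type*} [Nontrivial A] :
    (∀ n : ℕ, 2 ≤ n →
      ¬ CCS.HasFiniteGroundCompleteAxiomatisation
          (A := A) (CCS.NestedTraceEquiv CCS.Step n) ∧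
      ¬ CCS.HasFiniteGroundCompleteAxiomatisation
          (A := A) (CCS.NestedSimEquiv CCS.Step n)) ∧
    (∀ a b : A, a ≠ b →
      (∀ N : ℕ, 1 ≤ N → CCS.SoundEq (CCS.Bisimilar CCS.Step) (CCS.eEq a b N)) ∧
      (∀ E : Set (CCS.Equation A), E.Finite → CCS.Sound (CCS.PFEquiv CCS.Step) E →
        ∃ N₀ : ℕ, ∀ N : ℕ, N₀ ≤ N →
          ¬ CCS.Derivable E (CCS.eEq a b N).1 (CCS.eEq a b N).2)) := by
  refine ⟨fun n hn => ?_, fun a b hab => ⟨fun N _ σ => ?_, fun E hfin hE => ?_⟩⟩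
  · obtain ⟨n, rfl⟩ := Nat.exists_eq_add_of_le' hn
    exact ⟨CCS.not_hasFiniteGroundCompleteAxiomatisation
        (fun _ _ h => h.nestedTraceEquiv _) fun _ _ h => h.pfEquiv,
      CCS.not_hasFiniteGroundCompleteAxiomatisation
        (fun _ _ h => h.nestedSimEquiv _) fun _ _ h => h.pfEquiv⟩
  · simpa only [CCS.eEq, CCS.toTerm_subst] using CCS.bisimilar_eLHS_eRHS a b N
  · exact CCS.exists_forall_not_derivable_eEq hab hfin hE
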